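/- Let $\mu\subseteq\lambda$ be strict partitions (finite strictly decreasing sequences of positive integers with $\mu_i\le\lambda_i$ for all $i$, missing parts being $0$), and let $$D=\widetilde{\lambda/\mu}=\{(i,j) : 1\le i\le \ell(\lambda),\ i+\mu_i\le j\le i+\lambda_i-1\}$$ be the shifted skew diagram, $(i,j)$ being the box in row $i$ and column $j$. A marked shifted tableau of shape $D$ is a filling of the boxes of $D$ with letters of the ordered alphabet $1'<1<2'<2<\cdots$ such that rows and columns are weakly increasing, every column contains each unmarked letter $k$ at most once, and every row contains each marked letter $k'$ at most once. The skew Schur $Q$-function is the formal power series $Q_{\lambda/\mu}=\sum_T x^{c(T)}\in\mathbb{Q}[[x_1,x_2,\dots]]$, summed over all marked shifted tableaux $T$ of shape $D$, where $x^{c(T)}=\prod_k x_k^{c_k}$ and $c_k$ is the number of boxes of $T$ containing $k$ or $k'$. For a partition $\nu=(\nu_1,\dots,\nu_\ell)$ let $p_\nu=p_{\nu_1}\cdots p_{\nu_\ell}$, where $p_r=\sum_i x_i^r$. A power series is called $p$-positive if it is a finite linear combination of the $p_\nu$ with nonnegative rational coefficients. The diagram $D$ is called a ribbon (connected or not) if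 it does not contain both $(i,j)$ and $(i-1,j-1)$ for any $i,j$. (1) Suppose that $D$ contains the three boxes $(i,j)$, $(i,j+1)$ and $(i+1,j+1)$ for some $i,j$. If $Q_{\lambda/\mu}=\sum_\nu a_\nu p_\nu$ is a finite sum over partitions $\nu$ with $a_\nu\in\mathbb{Q}$, then $\sum_\nu a_\nu=0$. Moreover, $Q_{\lambda/\mu}$ is not $p$-positive. (2) If $Q_{\lambda/\mu}$ is $p$-positive, then $D$ is a ribbon. -/

import Mathlib

namespace SchurQ

/-- A strict partition: a finite strictly decreasing sequence of positive integers. -/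
structure StrictPartition where
  parts : List ℕ
  strict : parts.Pairwise (fun a b => b < a)
  pos : ∀ a ∈ parts, 0 < a

/-- The number of parts. -/
def StrictPartition.length (lam : StrictPartition) : ℕ := lam.parts.length

/-- The `i`-th part for `i ≥ 1` (parts are numbered from `1`), equal to `0` beyond the length. -/
def StrictPartition.part (lam : StrictPartition) (i : ℕ) : ℕ := lam.parts.getD (i - 1) 0

/-- Containment of strict partitions: `mu_i ≤ lam_i` for all `i ≥ 1`. -/
def StrictPartition.Contained (mu lam : StrictPartition) : Prop :=
  ∀ i, 1 ≤ i → mu.part i ≤ lam.part i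

/-- The shifted diagram `{(i, j) | 1 ≤ i ≤ ℓ(lam), i ≤ j ≤ i + lam_i - 1}`;
a box is a pair (row, column). -/
def shiftedDiagram (lam : StrictPartition) : Finset (ℕ × ℕ) :=
  (Finset.Icc 1 lam.length).biUnion fun i => {i} ×ˢ Finset.Ico i (i + lam.part i)

theorem mem_shiftedDiagram (lam : StrictPartition) (i j : ℕ) :
    (i, j) ∈ shiftedDiagram lam ↔
      (1 ≤ i ∧ i ≤ lam.length) ∧ i ≤ j ∧ j < i + lam.part i := by
  simp only [shiftedDiagram, Finset.mem_biUnion, Finset.mem_Icc, Finset.mem_product,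
    Finset.mem_singleton, Finset.mem_Ico]
  constructor
  · rintro ⟨k, hk, rfl, h⟩
    exact ⟨hk, h⟩
  · rintro ⟨hk, h⟩
    exact ⟨i, hk, rfl, h⟩

/-- The shifted skew diagram of `lam / mu` (used for `mu` contained in `lam`): the boxes of the
shifted diagram of `lam` that are not in the shifted diagram of `mu`. -/
def shiftedSkewDiagram (lam mu : StrictPartition) : Finset (ℕ × ℕ) :=
  shiftedDiagram lam \ shiftedDiagram mu

/-- A diagram is a ribbon if it never contains both `(i, j)` and `(i - 1, j - 1)`.
Connectedness is not part of the notion. -/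
def IsRibbon (D : Finset (ℕ × ℕ)) : Prop :=
  ∀ i j, (i + 1, j + 1) ∈ D → (i, j) ∉ D

/-- The ordered alphabet `1' < 1 < 2' < 2 < ⋯`: the marked letter `k'` is `(k, false)` and the
unmarked letter `k` is `(k, true)`, in lexicographic order. -/
abbrev Letter : Type := ℕ+ ×ₗ Bool

/-- The unmarked version `|a|` of a letter. -/
def Letter.abs (a : Letter) : ℕ+ := (ofLex a).1

/-- The letter is marked. -/
def Letter.IsMarked (a : Letter) : Prop := (ofLex a).2 = false

/-- Marked shifted tableaux of shape `D`. -/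
structure MarkedShiftedTableau (D : Finset (ℕ × ℕ)) where
  fill : D → Letter
  row_weak : ∀ b c : D, b.1.1 = c.1.1 → b.1.2 ≤ c.1.2 → fill b ≤ fill c
  col_weak : ∀ b c : D, b.1.2 = c.1.2 → b.1.1 ≤ c.1.1 → fill b ≤ fill c
  col_unmarked : ∀ b c : D, b.1.2 = c.1.2 → fill b = fill c → ¬ (fill b).IsMarked → b = c
  row_marked : ∀ b c : D, b.1.1 = c.1.1 → fill b = fill c → (fill b).IsMarked → b = c

/-- The content of a tableau: `c_k` is the number of boxes whose letter `a` has `|a| = k`. -/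
noncomputable def MarkedShiftedTableau.content {D : Finset (ℕ × ℕ)}
    (T : MarkedShiftedTableau D) : ℕ+ →₀ ℕ :=
  ∑ b : D, Finsupp.single (T.fill b).abs 1

/-- There are only finitely many tableaux of given shape and content, so that the cardinality
in the definition of `skewQ` is a true count. -/
theorem finite_tableaux (D : Finset (ℕ × ℕ)) (d : ℕ+ →₀ ℕ) :
    Finite {T : MarkedShiftedTableau D // T.content = d} := by
  have key : ∀ T : MarkedShiftedTableau D, T.content = d → ∀ b : D, (T.fill b).abs ∈ d.support := by
    intro T hT b
    rw [Finsupp.mem_support_iff, ← hT, MarkedShiftedTableau.content, Finsupp.finsetSum_apply]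
    intro h0
    have := (Finset.sum_eq_zero_iff.mp h0) b (Finset.mem_univ b)
    simp at this
  refine Finite.of_injective
    (β := D → d.support × Bool)
    (fun T b => (⟨(T.1.fill b).abs, key T.1 T.2 b⟩, (ofLex (T.1.fill b)).2)) ?_
  rintro ⟨⟨f, _, _, _, _⟩, hf⟩ ⟨⟨g, _, _, _, _⟩, hg⟩ h
  have hfg : f = g := by
    funext b
    have hb := congrFun h b
    simp only [Prod.mk.injEq, Subtype.mk.injEq, Letter.abs] at hb
    exact ofLex.injective (Prod.ext hb.1 hb.2)
  subst hfg
  rfl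

/-- The skew Schur `Q`-function `Q_{lam/mu} = ∑_T x^{c(T)}`, a formal power series in
`x_1, x_2, …`: the coefficient of `x^d` is the number of marked shifted tableaux of content `d`. -/
noncomputable def skewQ (lam mu : StrictPartition) : MvPowerSeries ℕ+ ℚ :=
  fun d => (Nat.card
    {T : MarkedShiftedTableau (shiftedSkewDiagram lam mu) // T.content = d} : ℚ)

open Classical in
/-- The power sum `p_r = ∑_i x_i ^ r` for `r ≥ 1`, given by its coefficients: the
coefficient of a monomial is `1` if the monomial is some `x_i ^ r`, and `0` otherwise. -/
noncomputable def powerSum (r : ℕ) : MvPowerSeries ℕ+ ℚ :=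
  fun d => if ∃ i : ℕ+, d = Finsupp.single i r then 1 else 0

/-- All partitions, of all nonnegative integers. -/
abbrev AnyPartition : Type := Σ n : ℕ, n.Partition

/-- The power sum symmetric function `p_ν = p_{ν_1} p_{ν_2} ⋯`. -/
noncomputable def powerSumPart (nu : AnyPartition) : MvPowerSeries ℕ+ ℚ :=
  (nu.2.parts.map powerSum).prod

/-- `f = ∑_ν a_ν p_ν`, a finite sum. -/
def IsPExpansion (f : MvPowerSeries ℕ+ ℚ) (a : AnyPartition →₀ ℚ) : Prop :=
  f = a.sum fun nu c => c • powerSumPart nu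

/-- `f` is `p`-positive: a finite linear combination of the `p_ν` with nonnegative
coefficients. -/
def IsPPositive (f : MvPowerSeries ℕ+ ℚ) : Prop :=
  ∃ a : AnyPartition →₀ ℚ, (∀ nu, 0 ≤ a nu) ∧ IsPExpansion f a

end SchurQ

namespace SchurQ

/-! Keep only the variable `x_1`. Each `p_ν` becomes `x_1 ^ |ν|`, so the `a_ν` with `|ν| = n` add up
to the coefficient of `x_1 ^ n`. On the other side, that coefficient of `Q` counts fillings by `1'`
and `1` alone, and a corner `(i, j)`, `(i, j + 1)`, `(i + 1, j + 1)` allows none (`not_abs_eq`).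
Hence the `a_ν` sum to zero; if they are nonnegative they all vanish, contradicting `skewQ_ne_zero`.
A diagram that is not a ribbon contains such a corner because the parts of `lam` strictly decrease
(`mem_shiftedSkewDiagram_of_diagonal`). -/

/-- On pure powers of the first variable a power sum of positive degree has a single coefficient
`1`. -/
theorem coeff_single_powerSum {r : ℕ} (hr : 0 < r) (n : ℕ) :
    MvPowerSeries.coeff (Finsupp.single (1 : ℕ+) n) (powerSum r) = if n = r then 1 else 0 := by
  classical
  rw [MvPowerSeries.coeff_apply, powerSum]
  refine if_congr ⟨?_, fun h => ⟨1, by rw [h]⟩⟩ rfl rfl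
  rintro ⟨i, h⟩
  rcases (Finsupp.single_eq_single_iff _ _ _ _).mp h with h | h
  · exact h.2
  · omega

/-- A pure power factors only into pure powers of the same variable. -/
theorem coeff_single_mul {σ R : Type*} [DecidableEq σ] [CommSemiring R] (i : σ) (n : ℕ)
    (f g : MvPowerSeries σ R) :
    MvPowerSeries.coeff (Finsupp.single i n) (f * g) =
      ∑ p ∈ Finset.HasAntidiagonal.antidiagonal n, MvPowerSeries.coeff (Finsupp.single i p.1) f *
        MvPowerSeries.coeff (Finsupp.single i p.2) g := by
  rw [MvPowerSeries.coeff_mul, Finsupp.antidiagonal_single, Finset.sum_map]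
  rfl

theorem coeff_single_prod_powerSum (s : Multiset ℕ) (hs : ∀ r ∈ s, 0 < r) (n : ℕ) :
    MvPowerSeries.coeff (Finsupp.single (1 : ℕ+) n) (s.map powerSum).prod =
      if n = s.sum then 1 else 0 := by
  induction s using Multiset.induction_on generalizing n with
  | empty =>
    classical
    rw [Multiset.map_zero, Multiset.prod_zero, MvPowerSeries.coeff_one]
    exact if_congr (by simp) rfl rfl
  | cons r s ih =>
    have hr : 0 < r := hs r (Multiset.mem_cons_self r s)
    have ih' := ih fun t ht => hs t (Multiset.mem_cons_of_mem ht)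
    rw [Multiset.map_cons, Multiset.prod_cons, coeff_single_mul]
    simp only [coeff_single_powerSum hr, ih', Multiset.sum_cons, mul_ite, mul_one, mul_zero,
      ← ite_and]
    have key : ∀ p : ℕ × ℕ, (p.2 = s.sum ∧ p.1 = r) ↔ p = (r, s.sum) := fun p => by
      rw [Prod.ext_iff, and_comm]
    simp only [key, Finset.sum_ite_eq', Finset.HasAntidiagonal.mem_antidiagonal]
    exact if_congr eq_comm rfl rfl

theorem coeff_single_powerSumPart (nu : AnyPartition) (n : ℕ) :
    MvPowerSeries.coeff (Finsupp.single (1 : ℕ+) n) (powerSumPart nu) =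
      if nu.1 = n then 1 else 0 := by
  rw [powerSumPart, coeff_single_prod_powerSum _ fun r hr => nu.2.parts_pos hr, nu.2.parts_sum]
  simp only [eq_comm]

/-- If no power of the first variable occurs in `f`, the coefficients of every power sum
expansion of `f` add up to `0`. -/
theorem IsPExpansion.sum_eq_zero {f : MvPowerSeries ℕ+ ℚ} {a : AnyPartition →₀ ℚ}
    (h : IsPExpansion f a)
    (hf : ∀ n, MvPowerSeries.coeff (Finsupp.single (1 : ℕ+) n) f = 0) :
    (a.sum fun _ c => c) = 0 := by
  classical
  -- Group the partitions by size; the group of size `n` sums to the coefficient of `x_1 ^ n`.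
  rw [Finsupp.sum, ← Finset.sum_fiberwise_of_maps_to (t := a.support.image Sigma.fst)
    fun nu hnu => Finset.mem_image_of_mem _ hnu]
  refine Finset.sum_eq_zero fun n _ => ?_
  rw [← hf n, h, Finsupp.sum, map_sum, Finset.sum_filter]
  refine Finset.sum_congr rfl fun nu _ => ?_
  rw [map_smul, coeff_single_powerSumPart, smul_eq_mul, mul_ite, mul_one, mul_zero]

theorem not_isPPositive_of_coeff_single {f : MvPowerSeries ℕ+ ℚ} (hne : f ≠ 0)
    (hf : ∀ n, MvPowerSeries.coeff (Finsupp.single (1 : ℕ+) n) f = 0) : ¬ IsPPositive f := by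
  rintro ⟨a, ha, h⟩
  have hsum := h.sum_eq_zero hf
  rw [Finsupp.sum, Finset.sum_eq_zero_iff_of_nonneg fun nu _ => ha nu] at hsum
  refine hne ?_
  rw [h]
  exact Finset.sum_eq_zero fun nu hnu => by simp only [hsum nu hnu, zero_smul]

theorem MarkedShiftedTableau.abs_mem_support_content {D : Finset (ℕ × ℕ)}
    (T : MarkedShiftedTableau D) (b : D) : (T.fill b).abs ∈ T.content.support := by
  rw [Finsupp.mem_support_iff, MarkedShiftedTableau.content, Finsupp.finsetSum_apply]
  intro h0
  have := (Finset.sum_eq_zero_iff.mp h0) b (Finset.mem_univ b)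
  simp at this

/-- Three boxes `(i, j)`, `(i, j + 1)`, `(i + 1, j + 1)` cannot be filled with letters of the
same absolute value. -/
theorem MarkedShiftedTableau.not_abs_eq {D : Finset (ℕ × ℕ)} (T : MarkedShiftedTableau D)
    {i j : ℕ} (h1 : (i, j) ∈ D) (h2 : (i, j + 1) ∈ D) (h3 : (i + 1, j + 1) ∈ D) (k : ℕ+) :
    ¬ ∀ b : D, (T.fill b).abs = k := by
  intro hk
  have ext_letter : ∀ b c : D, (ofLex (T.fill b)).2 = (ofLex (T.fill c)).2 →
      T.fill b = T.fill c := fun b c h =>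
    ofLex.injective (Prod.ext ((hk b).trans (hk c).symm) h)
  -- With equal absolute values, the order only compares marks, and `k' < k` is `false < true`.
  have snd_le : ∀ b c : D, T.fill b ≤ T.fill c →
      (ofLex (T.fill b)).2 ≤ (ofLex (T.fill c)).2 := by
    intro b c h
    rcases Prod.Lex.le_iff.mp h with h | h
    · exact absurd ((hk b).trans (hk c).symm) h.ne
    · exact h.2
  have hrow := snd_le _ _ (T.row_weak ⟨_, h1⟩ ⟨_, h2⟩ rfl (Nat.le_succ j))
  have hcol := snd_le _ _ (T.col_weak ⟨_, h2⟩ ⟨_, h3⟩ rfl (Nat.le_succ i))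
  -- The corner box decides: `k'` there forces `k'` to its left, repeated in the row; `k` forces `k`
  -- below it, repeated in the column.
  cases hb : (ofLex (T.fill ⟨_, h2⟩)).2 with
  | false =>
    have ha : (ofLex (T.fill ⟨_, h1⟩)).2 = false := by
      rw [hb] at hrow
      exact Bool.eq_false_of_le_false hrow
    have := T.row_marked ⟨_, h1⟩ ⟨_, h2⟩ rfl (ext_letter _ _ (ha.trans hb.symm)) ha
    simp at this
  | true =>
    have hc : (ofLex (T.fill ⟨_, h3⟩)).2 = true := by
      rw [hb] at hcol
      exact Bool.eq_true_of_true_le hcol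
    have hm : ¬ (T.fill ⟨_, h2⟩).IsMarked := by
      rw [Letter.IsMarked, hb]
      exact Bool.noConfusion
    have := T.col_unmarked ⟨_, h2⟩ ⟨_, h3⟩ rfl (ext_letter _ _ (hb.trans hc.symm)) hm
    simp at this

/-- The tableau all of whose boxes in row `i` contain the unmarked letter `i + 1`. -/
def rowTableau (D : Finset (ℕ × ℕ)) : MarkedShiftedTableau D where
  -- The shift by one makes the letter positive even for row `0`, which a general `D` may contain.
  -- Columns increase strictly, and the row rule is void without marks.
  fill b := toLex (b.1.1.succPNat, true)
  row_weak b c h _ := by rw [h]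
  col_weak b c _ h := Prod.Lex.toLex_mono ⟨Nat.succPNat_le_succPNat.mpr h, le_rfl⟩
  col_unmarked b c h he _ := by
    have h1 := congrArg (fun a => (ofLex a).1) he
    exact Subtype.ext (Prod.ext (Nat.succPNat_injective h1) h)
  row_marked b c _ _ hm := absurd hm Bool.noConfusion

theorem skewQ_ne_zero (lam mu : StrictPartition) : skewQ lam mu ≠ 0 := by
  intro h
  let T := rowTableau (shiftedSkewDiagram lam mu)
  have h0 : skewQ lam mu T.content = 0 := by rw [h]; rfl
  have := finite_tableaux (shiftedSkewDiagram lam mu) T.content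
  have : Nonempty {S : MarkedShiftedTableau (shiftedSkewDiagram lam mu) //
    S.content = T.content} := ⟨⟨T, rfl⟩⟩
  exact Nat.card_pos.ne' (Nat.cast_eq_zero.mp h0)

theorem coeff_single_skewQ_eq_zero (lam mu : StrictPartition) {i j : ℕ}
    (h1 : (i, j) ∈ shiftedSkewDiagram lam mu) (h2 : (i, j + 1) ∈ shiftedSkewDiagram lam mu)
    (h3 : (i + 1, j + 1) ∈ shiftedSkewDiagram lam mu) (k : ℕ+) (n : ℕ) :
    MvPowerSeries.coeff (Finsupp.single k n) (skewQ lam mu) = 0 := by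
  have : IsEmpty {T : MarkedShiftedTableau (shiftedSkewDiagram lam mu) //
      T.content = Finsupp.single k n} := by
    refine ⟨fun T => T.1.not_abs_eq h1 h2 h3 k fun b => ?_⟩
    have hb := T.1.abs_mem_support_content b
    rw [T.2] at hb
    exact Finset.mem_singleton.mp (Finsupp.support_single_subset hb)
  change ((Nat.card _ : ℕ) : ℚ) = 0
  rw [Nat.card_of_isEmpty, Nat.cast_zero]

theorem StrictPartition.part_succ_lt (lam : StrictPartition) {i : ℕ} (hi : 1 ≤ i)
    (hl : i + 1 ≤ lam.length) : lam.part (i + 1) < lam.part i := by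
  have hl' : i < lam.parts.length := hl
  rw [part, part, Nat.add_sub_cancel, List.getD_eq_getElem _ _ hl',
    List.getD_eq_getElem _ _ (by omega : i - 1 < lam.parts.length)]
  exact List.pairwise_iff_getElem.mp lam.strict _ _ _ _ (by omega)

/-- With two diagonally adjacent boxes a shifted skew diagram contains the box to the right of
the upper one. -/
theorem mem_shiftedSkewDiagram_of_diagonal (lam mu : StrictPartition) {i j : ℕ}
    (h1 : (i, j) ∈ shiftedSkewDiagram lam mu)
    (h3 : (i + 1, j + 1) ∈ shiftedSkewDiagram lam mu) :
    (i, j + 1) ∈ shiftedSkewDiagram lam mu := by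
  simp only [shiftedSkewDiagram, Finset.mem_sdiff, mem_shiftedDiagram] at h1 h3 ⊢
  obtain ⟨⟨⟨hi, hil⟩, hij, -⟩, hmu⟩ := h1
  obtain ⟨⟨⟨-, hil'⟩, -, hj⟩, -⟩ := h3
  -- Strictness turns `j + 1 < (i + 1) + lam_{i+1}` into `j + 1 < i + lam_i`. A box `(i, j + 1)` in
  -- the diagram of `mu` would put `(i, j)` there too, since `i ≤ j`.
  have := lam.part_succ_lt hi hil'
  exact ⟨⟨⟨hi, hil⟩, by omega, by omega⟩, fun h => hmu ⟨h.1, hij, by omega⟩⟩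

end SchurQ

theorem mainTheorem6 (lam mu : SchurQ.StrictPartition) (hmu : mu.Contained lam) :
    (∀ i j : ℕ,
      (i, j) ∈ SchurQ.shiftedSkewDiagram lam mu →
      (i, j + 1) ∈ SchurQ.shiftedSkewDiagram lam mu →
      (i + 1, j + 1) ∈ SchurQ.shiftedSkewDiagram lam mu →
        (∀ a : SchurQ.AnyPartition →₀ ℚ,
          SchurQ.IsPExpansion (SchurQ.skewQ lam mu) a → (a.sum fun _ c => c) = 0) ∧
        ¬ SchurQ.IsPPositive (SchurQ.skewQ lam mu)) ∧
    (SchurQ.IsPPositive (SchurQ.skewQ lam mu) →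
      SchurQ.IsRibbon (SchurQ.shiftedSkewDiagram lam mu)) := by
  have main : ∀ i j : ℕ,
      (i, j) ∈ SchurQ.shiftedSkewDiagram lam mu →
      (i, j + 1) ∈ SchurQ.shiftedSkewDiagram lam mu →
      (i + 1, j + 1) ∈ SchurQ.shiftedSkewDiagram lam mu →
        (∀ a : SchurQ.AnyPartition →₀ ℚ,
          SchurQ.IsPExpansion (SchurQ.skewQ lam mu) a → (a.sum fun _ c => c) = 0) ∧
        ¬ SchurQ.IsPPositive (SchurQ.skewQ lam mu) := fun i j h1 h2 h3 =>
    have h0 := SchurQ.coeff_single_skewQ_eq_zero lam mu h1 h2 h3 1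
    ⟨fun _ ha => ha.sum_eq_zero h0,
      SchurQ.not_isPPositive_of_coeff_single (SchurQ.skewQ_ne_zero lam mu) h0⟩
  refine ⟨main, fun hpos i j h3 h1 => ?_⟩
  exact (main i j h1 (SchurQ.mem_shiftedSkewDiagram_of_diagonal lam mu h1 h3) h3).2 hpos
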